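/- **Setting.** A transition system $TS=(\mathit{Init},\delta,\mathit{Bad})$ over a finite propositional vocabulary $\Sigma$, $n=|\Sigma|$, consists of propositional formulas $\mathit{Init},\mathit{Bad}$ over $\Sigma$ and $\delta$ over $\Sigma\uplus\Sigma'$. An inductive invariant is a formula $I$ over $\Sigma$ with $\mathit{Init}\Rightarrow I$, $I\wedge\delta\Rightarrow I'$ and $I\Rightarrow\neg\mathit{Bad}$. Given a polynomial $p(n)=\Omega(n)$, *polynomial-length inference* for a class $\mathcal P$ of transition systems is the problem to decide, for a given $TS\in\mathcal P$, whether it has an inductive invariant in $\mathrm{CNF}_{p(n)}$, the set of CNF formulas with at most $p(n)$ clauses. **The class $\mathcal P_{\Sigma_2}$.** It consists of the systems $TS_\phi$ for all $k\in\mathbb N$ and all propositional formulas $\phi(y_1,\dots,y_k,x_1,\dots,x_k)$. The vocabulary of $TS_\phi$ is $\{y_1,\dots,y_k,x_1,\dots,x_k,a,b,e\}$, so $n=2k+3$; $\mathit{Init}$ is $\vec y=\vec 0\wedge\vec x=\vec 0\wedge\neg a\wedge b\wedge\neg e$; $\mathit{Bad}$ is $e$. One step of $\delta_\phi$ evaluates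 $\phi(\vec y,\vec x)$ in the pre-state and performs the following changes in order: if the result is false, set $a$ to true; if $\vec x=\vec 1$ and $a$ is still false, set $b$ to false; if $\vec x=\vec 1$ in the pre-state, increment $\vec y$ lexicographically, reset $a$ to false and set $\vec x=\vec 0$, and otherwise increment $\vec x$ lexicographically; if $\vec y=\vec 1$ in the pre-state, set $e$ to $b$. (Here $y_k$, $x_k$ are the most significant bits, the increment of $\vec 1$ is $\vec 0$, and variables that are not mentioned keep their values.) **Interpolation queries.** For formulas $\alpha,\beta$ over $\Sigma$ let $H^k_\delta(\alpha,\beta)$ be the statement that $$\alpha(\Sigma^0)\wedge\delta(\Sigma^0,\Sigma^1)\wedge\dots\wedge\delta(\Sigma^{k-1},\Sigma^k)\Longrightarrow\beta(\Sigma^k)$$ is valid. An *interpolation-query oracle* $Q$ is a function that for all $\delta,\alpha,\beta$ and $k_1,k_2\in\mathbb N$ returns $\bot$ if $H^{k_1+k_2}_\delta(\alpha,\beta)$ fails, and otherwise returns some formula $\rho$ over $\Sigma$ such that $H^{k_1}_\delta(\alpha,\rho)$ and $H^{k_2}_\delta(\rho,\beta)$ hold. An *interpolation-query algorithm* is a deterministic,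 computationally unrestricted procedure that is given $\Sigma,\mathit{Init},\mathit{Bad}$, but accesses $\delta$ only by adaptively choosing $(\alpha,\beta,k_1,k_2)$ and receiving the answer of $Q$ for $\delta$, where $k_1,k_2$ are bounded by a polynomial in $n$ in all queries. It *decides* polynomial-length inference for $\mathcal P$ if for every interpolation-query oracle $Q$ and every $TS\in\mathcal P$ it halts with the correct answer. Its *query complexity* $q(n)\in\mathbb N\cup\{\infty\}$ is the supremum, over all interpolation-query oracles $Q$ and all $TS\in\mathcal P$ with $|\Sigma|=n$, of the number of queries that it performs. **Theorem.** Let $p(n)=\Omega(n)$ be a polynomial. Every interpolation-query algorithm, even computationally unrestricted, that decides polynomial-length inference for $\mathcal P_{\Sigma_2}$ has query complexity $2^{\Omega(n)}$: there is $c>0$ such that $q(n)\ge 2^{cn}$ for all sufficiently large $n$ of the form $n=2k+3$. -/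

import Mathlib

open Filter
open scoped ENNReal

/-! ## Propositional formulas -/

/-- Propositional formulas whose variables are the elements of `V`. -/
inductive PropFormula (V : Type) : Type
  | tru : PropFormula V
  | fls : PropFormula V
  | var : V → PropFormula V
  | neg : PropFormula V → PropFormula V
  | and : PropFormula V → PropFormula V → PropFormula V
  | or : PropFormula V → PropFormula V → PropFormula V

/-- A state over the vocabulary `V` is a valuation of `V`. -/
abbrev PropState (V : Type) : Type := V → Bool

namespace PropFormula

variable {V W : Type}

/-- The truth value of a formula in a state. -/
def eval (s : PropState V) : PropFormula V → Bool
  | tru => true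
  | fls => false
  | var v => s v
  | neg f => !(eval s f)
  | and f g => eval s f && eval s g
  | or f g => eval s f || eval s g

/-- `s ⊨ f`. -/
def Holds (f : PropFormula V) (s : PropState V) : Prop := f.eval s = true

/-- Renaming of variables. -/
def rename (r : V → W) : PropFormula V → PropFormula W
  | tru => tru
  | fls => fls
  | var v => var (r v)
  | neg f => neg (rename r f)
  | and f g => and (rename r f) (rename r g)
  | or f g => or (rename r f) (rename r g)

/-- `f ↔ g`. -/
def iff (f g : PropFormula V) : PropFormula V := or (and f g) (and (neg f) (neg g))

/-- Exclusive or. -/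
def xor (f g : PropFormula V) : PropFormula V := or (and f (neg g)) (and (neg f) g)

/-- If `c` then `f` else `g`. -/
def ite (c f g : PropFormula V) : PropFormula V := or (and c f) (and (neg c) g)

/-- The conjunction of a list of formulas. -/
def bigAnd (l : List (PropFormula V)) : PropFormula V := l.foldr and tru

/-- The disjunction of a list of formulas. -/
def bigOr (l : List (PropFormula V)) : PropFormula V := l.foldr or fls

/-- The literal `v` (second component `true`) or `¬ v` (second component `false`). -/
def ofLiteral (l : V × Bool) : PropFormula V := if l.2 then var l.1 else neg (var l.1)

/-- The CNF formula with the given list of clauses, a clause being a list of literals. -/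
def ofClauses (C : List (List (V × Bool))) : PropFormula V :=
  bigAnd (C.map fun clause => bigOr (clause.map ofLiteral))

/-- `CNF_m`: the formulas in conjunctive normal form with at most `m` clauses. -/
def cnf (V : Type) (m : ℝ) : Set (PropFormula V) :=
  {I | ∃ C : List (List (V × Bool)), (C.length : ℝ) ≤ m ∧ I = ofClauses C}

end PropFormula

/-! ## Transition systems and inductive invariants -/

/-- A formula over `V ⊎ V'`: `Sum.inl v` is the variable `v` in the pre-state, and `Sum.inr v` is its
copy `v'` in the post-state. -/
abbrev TransFormula (V : Type) : Type := PropFormula (V ⊕ V)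

/-- `(s, s') ⊨ δ`. -/
def TransFormula.Step {V : Type} (δ : TransFormula V) (s s' : PropState V) : Prop :=
  PropFormula.Holds δ (Sum.elim s s')

/-- A propositional transition system over a finite vocabulary. -/
structure TransitionSystem : Type 1 where
  Voc : Type
  finite_voc : Finite Voc
  init : PropFormula Voc
  trans : TransFormula Voc
  bad : PropFormula Voc

attribute [instance] TransitionSystem.finite_voc

/-- `n = |Σ|`, the size of the vocabulary. -/
noncomputable def TransitionSystem.size (ts : TransitionSystem) : ℕ := Nat.card ts.Voc

/-- `I` is an inductive invariant: `Init ⟹ I`, `I ∧ δ ⟹ I'` and `I ⟹ ¬ Bad`. -/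
def TransitionSystem.IsInductiveInvariant (ts : TransitionSystem) (I : PropFormula ts.Voc) : Prop :=
  (∀ s, ts.init.Holds s → I.Holds s) ∧
  (∀ s s', I.Holds s → ts.trans.Step s s' → I.Holds s') ∧
  (∀ s, I.Holds s → ¬ ts.bad.Holds s)

/-- There is an inductive invariant in `CNF_{p(n)}`, where `n` is the size of the vocabulary. -/
def TransitionSystem.HasPolyInvariant (ts : TransitionSystem) (p : Polynomial ℝ) : Prop :=
  ∃ I ∈ PropFormula.cnf ts.Voc (p.eval (ts.size : ℝ)), ts.IsInductiveInvariant I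

/-! ## Interpolation-query oracles -/

/-- The `k`-bounded reachability check
`α(Σ⁰) ∧ δ(Σ⁰, Σ¹) ∧ … ∧ δ(Σᵏ⁻¹, Σᵏ) ⟹ β(Σᵏ)`.
A valuation of the `k + 1` copies of the vocabulary is a sequence of `k + 1` states. -/
def BoundedReach {V : Type} (δ : TransFormula V) (k : ℕ) (α β : PropFormula V) : Prop :=
  ∀ s : Fin (k + 1) → PropState V,
    α.Holds (s 0) → (∀ i : Fin k, δ.Step (s i.castSucc) (s i.succ)) → β.Holds (s (Fin.last k))

/-- Query oracles with the interface of interpolation queries: the input consists of a transition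
relation `δ` over some finite vocabulary, of formulas `α`, `β` and of numbers `k₁`, `k₂`; the output
is `⊥` (that is, `none`) or a formula. -/
abbrev ItpOracle : Type 1 :=
  (V : Type) → [Finite V] → TransFormula V → PropFormula V → PropFormula V → ℕ → ℕ →
    Option (PropFormula V)

/-- The family of all interpolation-query oracles. -/
def itp : Set ItpOracle :=
  {Q | ∀ (V : Type) [Finite V] (δ : TransFormula V) (α β : PropFormula V) (k₁ k₂ : ℕ),
    (¬ BoundedReach δ (k₁ + k₂) α β → Q V δ α β k₁ k₂ = none) ∧
    (BoundedReach δ (k₁ + k₂) α β →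
      ∃ ρ, Q V δ α β k₁ k₂ = some ρ ∧ BoundedReach δ k₁ α ρ ∧ BoundedReach δ k₂ ρ β)}

/-! ## Inference algorithms from queries -/

/-- The inputs of an interpolation query that are chosen by the algorithm. -/
structure ItpQuery (V : Type) : Type where
  pre : PropFormula V
  post : PropFormula V
  k₁ : ℕ
  k₂ : ℕ

/-- A history: the queries performed so far with their answers, the latest one first. -/
abbrev ItpHistory (V : Type) : Type := List (ItpQuery V × Option (PropFormula V))

/-- A computationally unrestricted inference algorithm from interpolation queries. It knows the
vocabulary, `Init` and `Bad`, but not the transition relation. On the basis of these and of the answers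
to the queries performed so far, it either performs another query (`Sum.inl`) or halts with a
yes/no answer (`Sum.inr`). The function `next` is arbitrary, and a run need not halt. -/
structure InferenceAlgorithm : Type 1 where
  next : (V : Type) → [Finite V] → (init bad : PropFormula V) → ItpHistory V → ItpQuery V ⊕ Bool

namespace InferenceAlgorithm

variable (A : InferenceAlgorithm)

/-- The next action of the algorithm after history `h`, on input `ts`. -/
def action (ts : TransitionSystem) (h : ItpHistory ts.Voc) : ItpQuery ts.Voc ⊕ Bool :=
  A.next ts.Voc ts.init ts.bad h

/-- The history of the run on `ts` with the oracle `Q` after `t` steps (constant after halting). -/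
def history (Q : ItpOracle) (ts : TransitionSystem) : ℕ → ItpHistory ts.Voc
  | 0 => []
  | t + 1 =>
    match A.action ts (history Q ts t) with
    | Sum.inl q => (q, Q ts.Voc ts.trans q.pre q.post q.k₁ q.k₂) :: history Q ts t
    | Sum.inr _ => history Q ts t

/-- The run on `ts` with the oracle `Q` performs the query `q`. -/
def Performs (Q : ItpOracle) (ts : TransitionSystem) (q : ItpQuery ts.Voc) : Prop :=
  ∃ t, A.action ts (A.history Q ts t) = Sum.inl q

/-- The run on `ts` with the oracle `Q` halts with the answer `ans`. -/
def HaltsWith (Q : ItpOracle) (ts : TransitionSystem) (ans : Bool) : Prop :=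
  ∃ t, A.action ts (A.history Q ts t) = Sum.inr ans

/-- The number of queries in the run on `ts` with the oracle `Q` (possibly infinite). -/
noncomputable def numQueries (Q : ItpOracle) (ts : TransitionSystem) : ℕ∞ :=
  ⨆ t : ℕ, ((A.history Q ts t).length : ℕ∞)

/-- The query complexity with respect to a family of oracles and a class of transition systems: the
worst case over the oracles in the family and the systems in the class with vocabulary of size `n`. -/
noncomputable def queryComplexity (𝒬 : Set ItpOracle) (P : Set TransitionSystem) (n : ℕ) : ℕ∞ :=
  ⨆ Q ∈ 𝒬, ⨆ ts ∈ P, ⨆ _ : ts.size = n, A.numQueries Q ts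

/-- In all runs on systems of the class `P`, the bounds `k₁` and `k₂` of all queries are bounded by a
polynomial in the size of the vocabulary, so that the algorithm is an interpolation-query algorithm. -/
def HasPolyDepth (P : Set TransitionSystem) : Prop :=
  ∃ r : Polynomial ℕ, ∀ Q ∈ itp, ∀ ts ∈ P, ∀ q, A.Performs Q ts q →
    q.k₁ ≤ r.eval ts.size ∧ q.k₂ ≤ r.eval ts.size

/-- The algorithm decides, for every system of the class `P` and with every interpolation-query
oracle, whether there is an inductive invariant in `CNF_{p(n)}`. -/
def DecidesInference (P : Set TransitionSystem) (p : Polynomial ℝ) : Prop :=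
  ∀ Q ∈ itp, ∀ ts ∈ P, ∃ ans : Bool, A.HaltsWith Q ts ans ∧ (ans = true ↔ ts.HasPolyInvariant p)

end InferenceAlgorithm

/-! ## The hard class of transition systems -/

/-- The vocabulary `{y₁, …, y_k, x₁, …, x_k, a, b, e}`. -/
inductive HardVar (k : ℕ) : Type
  | y : Fin k → HardVar k
  | x : Fin k → HardVar k
  | a : HardVar k
  | b : HardVar k
  | e : HardVar k
  deriving DecidableEq, Fintype

namespace HardVar

open PropFormula

variable {k : ℕ}

/-- A variable of the pre-state. -/
def cur (v : HardVar k) : TransFormula (HardVar k) := var (Sum.inl v)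

/-- A variable of the post-state. -/
def nxt (v : HardVar k) : TransFormula (HardVar k) := var (Sum.inr v)

/-- In the pre-state, the vector `z` (which is `y` or `x`) is the all-ones vector. -/
def allOnes (z : Fin k → HardVar k) : TransFormula (HardVar k) :=
  bigAnd ((List.finRange k).map fun i => cur (z i))

/-- Bit `i` of the lexicographic increment of the vector `z` of the pre-state, which flips `z i` when
all the bits of smaller index are true: the bit of largest index is the most significant one, and the
increment of the all-ones vector is the zero vector. -/
def incBit (z : Fin k → HardVar k) (i : Fin k) : TransFormula (HardVar k) :=
  xor (cur (z i)) (bigAnd (((List.finRange k).filter fun j => j < i).map fun j => cur (z j)))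

/-- `φ(y, x)` in the pre-state. In `φ` the variable `yᵢ` is `Sum.inl i`, and `xᵢ` is `Sum.inr i`. -/
def curFormula (φ : PropFormula (Fin k ⊕ Fin k)) : TransFormula (HardVar k) :=
  φ.rename fun v => Sum.inl (Sum.elim y x v)

/-- The value of `a` after: if `φ(y, x)` is false, set `a` to true. -/
def midA (φ : PropFormula (Fin k ⊕ Fin k)) : TransFormula (HardVar k) :=
  or (cur a) (neg (curFormula φ))

/-- The value of `b` after: if `x = 1` and `a` is still false, set `b` to false. -/
def midB (φ : PropFormula (Fin k ⊕ Fin k)) : TransFormula (HardVar k) :=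
  and (cur b) (neg (and (allOnes x) (neg (midA φ))))

/-- The transition relation: evaluate `φ(y, x)` and change `a` and `b` accordingly; if `x = 1` in the
pre-state, increment `y`, reset `a` to false and set `x = 0`, and otherwise increment `x`; if `y = 1` in
the pre-state, set `e` to `b`. -/
def hardTrans (φ : PropFormula (Fin k ⊕ Fin k)) : TransFormula (HardVar k) :=
  and (bigAnd ((List.finRange k).map fun i =>
    iff (nxt (y i)) (ite (allOnes x) (incBit y i) (cur (y i)))))
  (and (bigAnd ((List.finRange k).map fun i =>
    iff (nxt (x i)) (ite (allOnes x) fls (incBit x i))))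
  (and (iff (nxt a) (ite (allOnes x) fls (midA φ)))
  (and (iff (nxt b) (midB φ))
    (iff (nxt e) (ite (allOnes y) (midB φ) (cur e))))))

/-- `y = 0 ∧ x = 0 ∧ ¬ a ∧ b ∧ ¬ e`. -/
def hardInit (k : ℕ) : PropFormula (HardVar k) :=
  and (bigAnd ((List.finRange k).map fun i => neg (var (y i))))
  (and (bigAnd ((List.finRange k).map fun i => neg (var (x i))))
  (and (neg (var a)) (and (var b) (neg (var e)))))

/-- `e`. -/
def hardBad (k : ℕ) : PropFormula (HardVar k) := var e

end HardVar

/-- The transition system that is built from the formula `φ(y₁, …, y_k, x₁, …, x_k)`. -/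
def hardSystem (k : ℕ) (φ : PropFormula (Fin k ⊕ Fin k)) : TransitionSystem where
  Voc := HardVar k
  finite_voc := inferInstance
  init := HardVar.hardInit k
  trans := HardVar.hardTrans φ
  bad := HardVar.hardBad k

/-- The class `P_{Σ₂}`, the union over all `k` of the classes of the systems built from `φ`. -/
def hardClass : Set TransitionSystem := {ts | ∃ k φ, ts = hardSystem k φ}

/-! The lower bound is an adversary argument. The pair `(y, x)` is a counter whose motion does not
depend on `φ`, so a run of `t` steps consults `φ` only at `t` successive counter values, which are
distinct while `t ≤ 2 ^ (2 * k)`. The adversary keeps a small set `D` of valuations at which `φ` is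
already fixed and answers every query so that the answer is correct for all `φ` with these values
(`exists_answer`). If the reachability check holds for every such `φ`, the answer is the set of
states reachable in `k₁` steps under some such `φ`. A run of one system followed by a run of another
is a run of a third one with the same values on `D`, since the two halves visit different counter
values; so this set is an interpolant for all of them at once. If the check fails for some `φ`,
fixing `φ` along one failing run makes `⊥` correct, at a cost of `k₁ + k₂` valuations.

After few queries `D` is small, and two completions remain (`exists_eqOn`). If `φ` is true off `D`,
some row `y = u` is constantly true, and "`y` does not pass `u` while `b` holds" yields a short
invariant. If `φ` is false off `D`, every row contains a false value, `b` survives, and `Bad` is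
reached. Both systems produce the same transcript, so an algorithm that has halted errs on one of
them. -/

/-! ## Semantics of formulas -/

namespace PropFormula

variable {V W : Type}

theorem eval_rename (r : V → W) (s : PropState W) (f : PropFormula V) :
    (f.rename r).eval s = f.eval (s ∘ r) := by
  induction f <;> simp_all [rename, eval]

theorem eval_bigAnd (s : PropState V) (l : List (PropFormula V)) :
    (bigAnd l).eval s = l.all fun f => f.eval s := by
  induction l <;> simp_all [bigAnd, eval]

theorem eval_bigOr (s : PropState V) (l : List (PropFormula V)) :
    (bigOr l).eval s = l.any fun f => f.eval s := by
  induction l <;> simp_all [bigOr, eval]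

@[simp]
theorem eval_iff (s : PropState V) (f g : PropFormula V) :
    (PropFormula.iff f g).eval s = (f.eval s == g.eval s) := by
  simp only [PropFormula.iff, eval]
  cases f.eval s <;> cases g.eval s <;> rfl

@[simp]
theorem eval_xor (s : PropState V) (f g : PropFormula V) :
    (PropFormula.xor f g).eval s = (f.eval s ^^ g.eval s) := by
  simp only [PropFormula.xor, eval]
  cases f.eval s <;> cases g.eval s <;> rfl

@[simp]
theorem eval_ite (s : PropState V) (c f g : PropFormula V) :
    (PropFormula.ite c f g).eval s = bif c.eval s then f.eval s else g.eval s := by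
  simp only [PropFormula.ite, eval]
  cases c.eval s <;> simp

theorem eval_ofLiteral (s : PropState V) (l : V × Bool) : (ofLiteral l).eval s = (s l.1 == l.2) := by
  rcases l with ⟨v, _ | _⟩ <;> simp [ofLiteral, eval]

theorem holds_ofClauses (s : PropState V) (C : List (List (V × Bool))) :
    (ofClauses C).Holds s ↔ ∀ c ∈ C, ∃ l ∈ c, s l.1 = l.2 := by
  simp [Holds, ofClauses, eval_bigAnd, eval_bigOr, eval_ofLiteral]

/-- Functional completeness: every Boolean function on the states is defined by a formula. -/
theorem exists_eval_eq [Finite V] (f : PropState V → Bool) :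
    ∃ φ : PropFormula V, ∀ s, φ.eval s = f s := by
  classical
  have := Fintype.ofFinite V
  refine ⟨bigOr ((Finset.univ.filter fun s => f s = true).toList.map fun s =>
    bigAnd (Finset.univ.toList.map fun v => ofLiteral (v, s v))), fun s => ?_⟩
  rw [Bool.eq_iff_iff]
  simp only [eval_bigOr, eval_bigAnd, eval_ofLiteral, List.any_map, List.any_eq_true,
    Function.comp, List.all_map, List.all_eq_true, Finset.mem_toList, Finset.mem_filter,
    Finset.mem_univ, true_and, beq_iff_eq, forall_const]
  constructor
  · rintro ⟨t, ht, h⟩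
    rwa [funext h]
  · exact fun h => ⟨s, h, fun _ => rfl⟩

end PropFormula

/-! ## The transition relation of a hard system as a function -/

namespace HardVar

variable {k : ℕ}

/-- The increment of a bit vector, the bit of largest index being the most significant one. -/
def incVec (z : Fin k → Bool) (i : Fin k) : Bool := z i ^^ decide (∀ j < i, z j = true)

/-- The valuation of `y` and `x` in a state. -/
def counter (s : PropState (HardVar k)) : PropState (Fin k ⊕ Fin k) := fun v => s (Sum.elim y x v)

/-- The increment of the pair `(y, x)`, `y` being the more significant part. -/
def incCounter (w : PropState (Fin k ⊕ Fin k)) : PropState (Fin k ⊕ Fin k)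
  | Sum.inl i => if ∀ j, w (Sum.inr j) = true then incVec (fun j => w (Sum.inl j)) i else w (Sum.inl i)
  | Sum.inr i => if ∀ j, w (Sum.inr j) = true then false else incVec (fun j => w (Sum.inr j)) i

/-- The value of `midA`. -/
def stepA (φ : PropFormula (Fin k ⊕ Fin k)) (s : PropState (HardVar k)) : Bool :=
  s a || !(φ.eval (counter s))

/-- The value of `midB`. -/
def stepB (φ : PropFormula (Fin k ⊕ Fin k)) (s : PropState (HardVar k)) : Bool :=
  s b && !(decide (∀ j, s (x j) = true) && !stepA φ s)

/-- The successor of a state. -/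
def hardStep (φ : PropFormula (Fin k ⊕ Fin k)) (s : PropState (HardVar k)) : PropState (HardVar k)
  | y i => incCounter (counter s) (Sum.inl i)
  | x i => incCounter (counter s) (Sum.inr i)
  | a => if ∀ j, s (x j) = true then false else stepA φ s
  | b => stepB φ s
  | e => if ∀ j, s (y j) = true then stepB φ s else s e

/-- The right-hand side does not mention `φ`: the places at which a run reads `φ` are known in
advance from its initial state. -/
theorem counter_hardStep (φ : PropFormula (Fin k ⊕ Fin k)) (s : PropState (HardVar k)) :
    counter (hardStep φ s) = incCounter (counter s) := by
  funext v
  cases v <;> rfl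

theorem eval_allOnes (z : Fin k → HardVar k) (s s' : PropState (HardVar k)) :
    (allOnes z).eval (Sum.elim s s') = decide (∀ j, s (z j) = true) := by
  rw [Bool.eq_iff_iff]
  simp [allOnes, PropFormula.eval_bigAnd, cur, PropFormula.eval]

theorem eval_incBit (z : Fin k → HardVar k) (i : Fin k) (s s' : PropState (HardVar k)) :
    (incBit z i).eval (Sum.elim s s') = incVec (fun j => s (z j)) i := by
  simp only [incBit, incVec, PropFormula.eval_xor]
  congr 1
  rw [Bool.eq_iff_iff]
  simp only [PropFormula.eval_bigAnd, cur, PropFormula.eval, List.all_map, List.all_eq_true,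
    List.mem_filter, List.mem_finRange, true_and, decide_eq_true_eq, Function.comp, Sum.elim_inl]

theorem eval_midA (φ : PropFormula (Fin k ⊕ Fin k)) (s s' : PropState (HardVar k)) :
    (midA φ).eval (Sum.elim s s') = stepA φ s := by
  simp only [midA, PropFormula.eval, cur, curFormula, PropFormula.eval_rename, stepA, Sum.elim_inl]
  rfl

theorem eval_midB (φ : PropFormula (Fin k ⊕ Fin k)) (s s' : PropState (HardVar k)) :
    (midB φ).eval (Sum.elim s s') = stepB φ s := by
  simp [midB, PropFormula.eval, cur, eval_allOnes, eval_midA, stepB]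

theorem step_hardTrans_iff (φ : PropFormula (Fin k ⊕ Fin k)) (s s' : PropState (HardVar k)) :
    (hardTrans φ).Step s s' ↔ s' = hardStep φ s := by
  have key : (hardTrans φ).Step s s' ↔ (∀ i, s' (y i) = hardStep φ s (y i)) ∧
      (∀ i, s' (x i) = hardStep φ s (x i)) ∧ s' a = hardStep φ s a ∧ s' b = hardStep φ s b ∧
      s' e = hardStep φ s e := by
    simp only [TransFormula.Step, PropFormula.Holds, hardTrans, PropFormula.eval,
      PropFormula.eval_bigAnd, List.all_map, Bool.and_eq_true, List.all_eq_true,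
      PropFormula.eval_iff, PropFormula.eval_ite, eval_allOnes, eval_incBit, eval_midA, eval_midB,
      nxt, cur, Sum.elim_inl, Sum.elim_inr, beq_iff_eq, Function.comp, List.mem_finRange,
      forall_const, Bool.cond_decide]
    rfl
  rw [key]
  constructor
  · rintro ⟨hy, hx, ha, hb, he⟩
    funext v
    cases v <;> simp_all
  · rintro rfl
    simp

theorem boundedReach_hardTrans_iff (φ : PropFormula (Fin k ⊕ Fin k)) (t : ℕ)
    (α β : PropFormula (HardVar k)) :
    BoundedReach (hardTrans φ) t α β ↔ ∀ s, α.Holds s → β.Holds ((hardStep φ)^[t] s) := by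
  constructor
  · intro h s hs
    refine h (fun i => (hardStep φ)^[i] s) hs fun i => ?_
    rw [step_hardTrans_iff]
    simp [Function.iterate_succ_apply']
  · intro h s hs hstep
    have key : ∀ i : Fin (t + 1), s i = (hardStep φ)^[i] (s 0) := by
      intro i
      induction i using Fin.induction with
      | zero => rfl
      | succ i ih =>
        rw [(step_hardTrans_iff _ _ _).1 (hstep i), ih]
        simp [Function.iterate_succ_apply']
    rw [key]
    exact h _ hs

theorem counter_iterate_hardStep (φ : PropFormula (Fin k ⊕ Fin k)) (s : PropState (HardVar k))
    (t : ℕ) : counter ((hardStep φ)^[t] s) = incCounter^[t] (counter s) := by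
  induction t with
  | zero => rfl
  | succ t ih => rw [Function.iterate_succ_apply', counter_hardStep, ih, Function.iterate_succ_apply']

theorem hardStep_congr {φ ψ : PropFormula (Fin k ⊕ Fin k)} {s : PropState (HardVar k)}
    (h : φ.eval (counter s) = ψ.eval (counter s)) : hardStep φ s = hardStep ψ s := by
  funext v
  cases v <;> simp [hardStep, stepB, stepA, h]

theorem iterate_hardStep_congr {φ ψ : PropFormula (Fin k ⊕ Fin k)} {s : PropState (HardVar k)}
    {t : ℕ} (h : ∀ i < t, φ.eval (incCounter^[i] (counter s)) = ψ.eval (incCounter^[i] (counter s))) :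
    (hardStep φ)^[t] s = (hardStep ψ)^[t] s := by
  induction t with
  | zero => rfl
  | succ t ih =>
    rw [Function.iterate_succ_apply', Function.iterate_succ_apply',
      ← ih fun i hi => h i (hi.trans (Nat.lt_succ_self t))]
    apply hardStep_congr
    rw [counter_iterate_hardStep]
    exact h t (Nat.lt_succ_self t)

/-! ### The counter -/

/-- The counter that shows the number `n` modulo `2 ^ (2 * k)`. -/
def counterOf (k n : ℕ) : PropState (Fin k ⊕ Fin k)
  | Sum.inl i => n.testBit (k + i)
  | Sum.inr i => n.testBit i

/-- Bit `i + 1` of a number is bit `i` of its half, and halving `n + 1` gives `n / 2` or `n / 2 + 1`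
according to the parity of `n`; hence the induction on `i` with `n` varying. -/
theorem testBit_succ_number (n i : ℕ) :
    (n + 1).testBit i = (n.testBit i ^^ decide (∀ j < i, n.testBit j = true)) := by
  induction i generalizing n with
  | zero =>
    rcases Nat.mod_two_eq_zero_or_one n with h | h <;> simp [Nat.testBit_zero, Nat.add_mod, h]
  | succ i ih =>
    have hall : (∀ j < i + 1, n.testBit j = true) ↔
        n.testBit 0 = true ∧ ∀ j < i, (n / 2).testBit j = true := by
      simp only [← Nat.testBit_succ]
      constructor
      · exact fun h => ⟨h 0 (by omega), fun j hj => h (j + 1) (by omega)⟩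
      · rintro ⟨h0, h⟩ (_ | j) hj
        · exact h0
        · exact h j (by omega)
    rw [Nat.testBit_succ, Nat.testBit_succ]
    simp only [hall]
    rcases Nat.mod_two_eq_zero_or_one n with h | h
    · have h2 : (n + 1) / 2 = n / 2 := by omega
      simp [h2, Nat.testBit_zero, h]
    · have h2 : (n + 1) / 2 = n / 2 + 1 := by omega
      rw [h2, ih]
      simp [Nat.testBit_zero, h]

theorem incCounter_counterOf (n : ℕ) : incCounter (counterOf k n) = counterOf k (n + 1) := by
  funext v
  cases v with
  | inl i =>
    simp only [incCounter, counterOf, incVec, testBit_succ_number n (k + i)]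
    have hall : (∀ j < k + (i : ℕ), n.testBit j = true) ↔
        (∀ j : Fin k, n.testBit j = true) ∧ ∀ j < i, n.testBit (k + j) = true := by
      constructor
      · exact fun h => ⟨fun j => h j (by omega), fun j hj => h _ (by simpa using hj)⟩
      · rintro ⟨h1, h2⟩ j hj
        rcases lt_or_ge j k with h | h
        · exact h1 ⟨j, h⟩
        · have := h2 ⟨j - k, by omega⟩ (by rw [Fin.lt_def]; simp only; omega)
          simpa [Nat.add_sub_cancel' h] using this
    simp only [hall]
    split_ifs with h
    · simp only [h, implies_true, true_and]
      congr
    · simp [h]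
  | inr i =>
    simp only [incCounter, counterOf, incVec, testBit_succ_number n i]
    have hall : (∀ j < (i : ℕ), n.testBit j = true) ↔ ∀ j < i, n.testBit j = true :=
      ⟨fun h j hj => h j hj, fun h j hj => h ⟨j, hj.trans i.2⟩ hj⟩
    simp only [hall]
    split_ifs with h
    · simp [h]
    · exact if_neg h

theorem iterate_incCounter_counterOf (n t : ℕ) :
    incCounter^[t] (counterOf k n) = counterOf k (n + t) := by
  induction t with
  | zero => rfl
  | succ t ih => rw [Function.iterate_succ_apply', ih, incCounter_counterOf]; rfl

theorem counterOf_eq_iff {n m : ℕ} :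
    counterOf k n = counterOf k m ↔ n % 2 ^ (2 * k) = m % 2 ^ (2 * k) := by
  constructor
  · intro h
    refine Nat.eq_of_testBit_eq fun i => ?_
    simp only [Nat.testBit_mod_two_pow]
    by_cases hi : i < 2 * k
    · simp only [hi, decide_true, Bool.true_and]
      rcases lt_or_ge i k with h' | h'
      · exact congrFun h (Sum.inr ⟨i, h'⟩)
      · simpa [counterOf, Nat.add_sub_cancel' h'] using congrFun h (Sum.inl ⟨i - k, by omega⟩)
    · simp [hi]
  · intro h
    have h' : ∀ i < 2 * k, n.testBit i = m.testBit i := by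
      intro i hi
      have := congrArg (fun r => Nat.testBit r i) h
      simpa [Nat.testBit_mod_two_pow, hi] using this
    funext v
    rcases v with i | i <;> exact h' _ (by omega)

theorem exists_counterOf_eq (w : PropState (Fin k ⊕ Fin k)) : ∃ n, counterOf k n = w := by
  -- The low bits belong to `x`, the right summand, while `finSumFinEquiv` lists the left summand
  -- first; hence the swap.
  refine ⟨Nat.ofBits (fun i : Fin (k + k) => w (Sum.swap (finSumFinEquiv.symm i))), ?_⟩
  funext v
  cases v with
  | inl i =>
    have := Nat.testBit_ofBits_lt (fun i : Fin (k + k) => w (Sum.swap (finSumFinEquiv.symm i)))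
      (k + i) (by omega)
    rw [counterOf, this]
    change w (Sum.swap (finSumFinEquiv.symm (Fin.natAdd k i))) = _
    rw [finSumFinEquiv_symm_apply_natAdd]
    rfl
  | inr i =>
    have := Nat.testBit_ofBits_lt (fun i : Fin (k + k) => w (Sum.swap (finSumFinEquiv.symm i)))
      i (by omega)
    rw [counterOf, this]
    change w (Sum.swap (finSumFinEquiv.symm (Fin.castAdd k i))) = _
    rw [finSumFinEquiv_symm_apply_castAdd]
    rfl

/-- The counter is addition of 1 modulo `2 ^ (2 * k)`. This is what separates the two halves of a
glued run. -/
theorem iterate_incCounter_inj (w : PropState (Fin k ⊕ Fin k)) {i j : ℕ} (hi : i < 2 ^ (2 * k))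
    (hj : j < 2 ^ (2 * k)) (h : incCounter^[i] w = incCounter^[j] w) : i = j := by
  obtain ⟨n, rfl⟩ := exists_counterOf_eq w
  rw [iterate_incCounter_counterOf, iterate_incCounter_counterOf, counterOf_eq_iff] at h
  exact Nat.ModEq.eq_of_lt_of_lt (Nat.ModEq.add_left_cancel' n h) hi hj

/-- Runs of two systems can be glued to a run of a third one, as long as the counter does not return
to an earlier value. -/
theorem iterate_hardStep_glue {φ ψ χ : PropFormula (Fin k ⊕ Fin k)} (s : PropState (HardVar k))
    (t₁ t₂ : ℕ) (h₁ : ∀ i < t₁, χ.eval (incCounter^[i] (counter s)) = φ.eval (incCounter^[i] (counter s)))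
    (h₂ : ∀ i < t₂, χ.eval (incCounter^[t₁ + i] (counter s)) = ψ.eval (incCounter^[t₁ + i] (counter s))) :
    (hardStep χ)^[t₁ + t₂] s = (hardStep ψ)^[t₂] ((hardStep φ)^[t₁] s) := by
  rw [Nat.add_comm, Function.iterate_add_apply, iterate_hardStep_congr h₁]
  apply iterate_hardStep_congr
  intro i hi
  rw [counter_iterate_hardStep, ← Function.iterate_add_apply, Nat.add_comm i]
  exact h₂ i hi

end HardVar

/-! ## Hard systems with and without short invariants -/

namespace HardVar

variable {k : ℕ}

/-- `z ≤ u` as binary numbers, in the form of a conjunction of clauses, one for each zero of `u`. -/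
def LexLE (z u : Fin k → Bool) : Prop :=
  ∀ i, u i = false → z i = false ∨ ∃ j > i, u j = true ∧ z j = false

/-- Suppose the clause at a zero `i` of `u` fails after the increment. If the carry reaches `i`,
then `z i` was 0 and stops it, so above `i` the vector `z` has all ones of `u`; together with `z ≤
u` this forces `z = u`. If the carry stops below `i`, the bits from `i` on are unchanged and the
clause failed already for `z`. -/
theorem LexLE.incVec {z u : Fin k → Bool} (h : LexLE z u) (hne : z ≠ u) : LexLE (incVec z) u := by
  intro i hui
  by_contra! hcon
  obtain ⟨hi, hgt⟩ := hcon
  simp only [ne_eq, Bool.not_eq_false] at hi hgt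
  by_cases hc : ∀ j < i, z j = true
  · have hzi : z i = false := by
      rw [HardVar.incVec, decide_eq_true hc] at hi
      simpa using hi
    have habove : ∀ j > i, u j = true → z j = true := by
      intro j hj hu
      have hnc : ¬ ∀ l < j, z l = true := fun hl => by simp [hl i hj] at hzi
      simpa [HardVar.incVec, hnc] using hgt j hj hu
    refine hne (funext fun j => ?_)
    have hfalse : u j = false → z j = false := by
      intro hu
      rcases lt_trichotomy j i with hj | rfl | hj
      · rcases h j hu with h0 | ⟨l, hl, hul, hzl⟩
        · exact h0
        · rcases lt_trichotomy l i with hli | rfl | hli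
          · simp [hc l hli] at hzl
          · simp [hui] at hul
          · simp [habove l hli hul] at hzl
      · exact hzi
      · rcases h j hu with h0 | ⟨l, hl, hul, hzl⟩
        · exact h0
        · simp [habove l (hj.trans hl) hul] at hzl
    have htrue : u j = true → z j = true := by
      intro hu
      rcases lt_trichotomy j i with hj | rfl | hj
      · exact hc j hj
      · simp [hui] at hu
      · exact habove j hj hu
    cases hu : u j
    · exact hfalse hu
    · exact htrue hu
  · have hsame : ∀ j, i ≤ j → HardVar.incVec z j = z j := by
      intro j hj
      have hnc : ¬ ∀ l < j, z l = true := fun hl => hc fun l hli => hl l (hli.trans_le hj)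
      simp [HardVar.incVec, hnc]
    rcases h i hui with h0 | ⟨j, hj, huj, hzj⟩
    · simp [← hsame i le_rfl, hi] at h0
    · simp [← hsame j hj.le, hgt j hj huj] at hzj

/-- The valuation of `y` and `x` with the given values. -/
def pair (u v : Fin k → Bool) : PropState (Fin k ⊕ Fin k) := Sum.elim u v

/-- The clauses of `¬ e ∧ (b → y ≤ u) ∧ (a ∧ b → y ≠ u)`. -/
def invClauses (u : Fin k → Bool) : List (List (HardVar k × Bool)) :=
  [(e, false)] :: ((a, false) :: (b, false) :: (List.finRange k).map fun i => (y i, !u i)) ::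
    ((List.finRange k).filter fun i => u i = false).map fun i =>
      (b, false) :: (y i, false) ::
        ((List.finRange k).filter fun j => i < j ∧ u j = true).map fun j => (y j, false)

theorem holds_invClauses (u : Fin k → Bool) (s : PropState (HardVar k)) :
    (PropFormula.ofClauses (invClauses u)).Holds s ↔
      s e = false ∧ (s a = true → s b = true → (fun i => s (y i)) ≠ u) ∧
        (s b = true → LexLE (fun i => s (y i)) u) := by
  have h1 : (∃ i, s (y i) = !u i) ↔ (fun i => s (y i)) ≠ u := by
    rw [ne_eq, funext_iff, not_forall]
    refine exists_congr fun i => ?_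
    cases s (y i) <;> cases u i <;> simp
  rw [PropFormula.holds_ofClauses, ← h1]
  simp only [invClauses, List.mem_cons, List.mem_map, List.mem_filter, List.mem_finRange, true_and,
    forall_eq_or_imp, exists_eq_or_imp, exists_exists_and_eq_and, exists_eq_left, decide_eq_true_eq,
    forall_exists_index, and_imp, forall_apply_eq_imp_iff₂, LexLE, List.not_mem_nil, or_false, exists_exists_eq_and, gt_iff_lt]
  cases s a <;> cases s b <;> simp [and_assoc]

/-- All zeros of `u` lie below `m` and contribute one clause each; the other two clauses are the one
for `e` and the one excluding `y = u`. Bounding the zeros matters because `p` may grow with a small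
linear coefficient. -/
theorem length_invClauses_le (u : Fin k → Bool) {m : ℕ} (hu : ∀ i : Fin k, m ≤ i → u i = true) :
    (invClauses u).length ≤ m + 2 := by
  have : ((List.finRange k).filter fun i => u i = false).length ≤ m := by
    have hnd : (((List.finRange k).filter fun i => u i = false).map Fin.val).Nodup :=
      ((List.nodup_finRange k).filter _).map Fin.val_injective
    have hsub : ((List.finRange k).filter fun i => u i = false).map Fin.val ⊆ List.range m := by
      intro i hi
      simp only [List.mem_map, List.mem_filter, List.mem_finRange, true_and,
        decide_eq_true_eq] at hi
      obtain ⟨i, hi, rfl⟩ := hi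
      rw [List.mem_range]
      by_contra! h
      simp [hu i h] at hi
    simpa using (hnd.subperm hsub).length_le
  simp only [invClauses, List.length_cons, List.length_map]
  omega

theorem of_holds_hardInit {s : PropState (HardVar k)} (hs : (hardInit k).Holds s) :
    (∀ i, s (y i) = false) ∧ s a = false ∧ s e = false := by
  simp only [PropFormula.Holds, hardInit, PropFormula.eval, PropFormula.eval_bigAnd,
    Bool.and_eq_true, List.all_map, List.all_eq_true, List.mem_finRange, Function.comp,
    forall_const, Bool.not_eq_true'] at hs
  exact ⟨hs.1, hs.2.2.1, hs.2.2.2.2⟩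

/-- The initial state of a hard system. -/
def initState (k : ℕ) : PropState (HardVar k)
  | b => true
  | _ => false

theorem holds_hardInit_initState (k : ℕ) : (hardInit k).Holds (initState k) := by
  simp [hardInit, PropFormula.Holds, PropFormula.eval, PropFormula.eval_bigAnd, initState]

/-- In the row `y = u` the formula never fails, so `a` stays false and `b` is cleared at the end of
the row, before `y` exceeds `u`. As `u` is not all ones, `e` is never set to a true `b`. -/
theorem isInductiveInvariant_invClauses {φ : PropFormula (Fin k ⊕ Fin k)} {u : Fin k → Bool}
    (hu : ¬ ∀ i, u i = true) (hφ : ∀ v, φ.eval (pair u v) = true) :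
    (hardSystem k φ).IsInductiveInvariant (PropFormula.ofClauses (invClauses u)) := by
  refine ⟨fun s hs => ?_, fun s s' hs hstep => ?_, fun s hs => ?_⟩
  · obtain ⟨hy, ha, he⟩ := of_holds_hardInit hs
    exact (holds_invClauses u s).2 ⟨he, by simp [ha], fun _ i _ => Or.inl (hy i)⟩
  · obtain ⟨he, hab, hb⟩ := (holds_invClauses u s).1 hs
    obtain rfl := (step_hardTrans_iff φ s s').1 hstep
    have hφs : (fun i => s (y i)) = u → φ.eval (counter s) = true := by
      intro h
      rw [← hφ fun i => s (x i)]
      congr 1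
      funext v
      cases v with
      | inl i => exact congrFun h i
      | inr i => rfl
    have hsb : stepB φ s = true → s b = true := fun h => by
      simp only [stepB, Bool.and_eq_true] at h
      exact h.1
    refine (holds_invClauses u _).2 ⟨?_, fun ha' hb' hu' => ?_, fun hb' => ?_⟩
    -- With `y` all ones and `b` true, `y ≤ u` would force `u` to be all ones.
    · by_cases hy : ∀ j, s (y j) = true
      · simp only [hardStep, hy, implies_true, if_true]
        by_contra hne
        refine hu fun i => ?_
        by_contra hi
        rcases hb (hsb (by simpa using hne)) i (by simpa using hi) with h | ⟨j, -, -, h⟩ <;>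
          simp [hy] at h
      · simpa [hardStep, hy] using he
    · by_cases hx : ∀ j, s (x j) = true
      · simp [hardStep, hx] at ha'
      · have hyu : (fun i => s (y i)) = u := by
          rw [← hu']
          funext i
          exact (if_neg hx).symm
        have hsa : s a = true := by simpa [hardStep, hx, stepA, hφs hyu] using ha'
        exact hab hsa (hsb hb') hyu
    · by_cases hx : ∀ j, s (x j) = true
      -- At the end of a row `b` survives only if `a` is true after the evaluation, which is
      -- impossible for `y = u`; so `y` is strictly below `u` and may be incremented.
      · have hA : stepA φ s = true := by
          have hb' : stepB φ s = true := hb'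
          simpa [stepB, hx, hsb hb'] using hb'
        have hne : (fun i => s (y i)) ≠ u := by
          intro hyu
          have hsa : s a = true := by simpa [stepA, hφs hyu] using hA
          exact hab hsa (hsb hb') hyu
        have := (hb (hsb hb')).incVec hne
        convert this using 1
        funext i
        exact if_pos hx
      · convert hb (hsb hb') using 1
        funext i
        exact if_neg hx
  · have := ((holds_invClauses u s).1 hs).1
    simp [hardSystem, hardBad, PropFormula.Holds, PropFormula.eval, this]

theorem hasPolyInvariant_hardSystem {φ : PropFormula (Fin k ⊕ Fin k)} {u : Fin k → Bool} {m : ℕ}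
    {p : Polynomial ℝ} (hm : ((m + 2 : ℕ) : ℝ) ≤ p.eval ((hardSystem k φ).size : ℝ))
    (hum : ∀ i : Fin k, m ≤ i → u i = true) (hu : ¬ ∀ i, u i = true)
    (hφ : ∀ v, φ.eval (pair u v) = true) : (hardSystem k φ).HasPolyInvariant p :=
  ⟨_, ⟨invClauses u, (Nat.cast_le.2 (length_invClauses_le u hum)).trans hm, rfl⟩,
    isInductiveInvariant_invClauses hu hφ⟩

theorem card_hardVar (k : ℕ) : Nat.card (HardVar k) = 2 * k + 3 := by
  let f : HardVar k ≃ (Fin k ⊕ Fin k) ⊕ Fin 3 :=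
    { toFun := fun v => match v with
        | y i => Sum.inl (Sum.inl i)
        | x i => Sum.inl (Sum.inr i)
        | a => Sum.inr 0
        | b => Sum.inr 1
        | e => Sum.inr 2
      invFun := fun v => match v with
        | Sum.inl (Sum.inl i) => y i
        | Sum.inl (Sum.inr i) => x i
        | Sum.inr 0 => a
        | Sum.inr 1 => b
        | Sum.inr 2 => e
      left_inv := fun v => by cases v <;> rfl
      right_inv := fun v => by
        rcases v with (i | i) | i
        · rfl
        · rfl
        · fin_cases i <;> rfl }
  rw [Nat.card_congr f]
  simp
  omega

/-! ### Unsafe systems: every row contains a false value. -/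

theorem forall_testBit_iff (n : ℕ) :
    (∀ j : Fin k, n.testBit j = true) ↔ n % 2 ^ k = 2 ^ k - 1 := by
  constructor
  · intro h
    refine Nat.eq_of_testBit_eq fun i => ?_
    rw [Nat.testBit_mod_two_pow, Nat.testBit_two_pow_sub_one]
    by_cases hi : i < k
    · simpa [hi] using h ⟨i, hi⟩
    · simp [hi]
  · intro h j
    have := congrArg (fun r => Nat.testBit r j) h
    simpa [Nat.testBit_mod_two_pow, Nat.testBit_two_pow_sub_one] using this

theorem counter_iterate_initState (φ : PropFormula (Fin k ⊕ Fin k)) (t : ℕ) :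
    counter ((hardStep φ)^[t] (initState k)) = counterOf k t := by
  have h0 : counter (initState k) = counterOf k 0 := by
    funext v
    rcases v with i | i <;> simp [counter, initState, counterOf]
  rw [counter_iterate_hardStep, h0, iterate_incCounter_counterOf, Nat.zero_add]

/-- At time `t` the counter shows `t`, with row `t / 2 ^ k`. Once a false value has occurred in the
current row, `a` stays true until the row ends; since each row has one, `b` is never cleared. -/
theorem iterate_hardStep_initState {φ : PropFormula (Fin k ⊕ Fin k)}
    (hφ : ∀ Y, ∃ X < 2 ^ k, φ.eval (counterOf k (2 ^ k * Y + X)) = false) (t : ℕ) :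
    ((hardStep φ)^[t] (initState k)) b = true ∧
      ∀ j < t, j / 2 ^ k = t / 2 ^ k → φ.eval (counterOf k j) = false →
        ((hardStep φ)^[t] (initState k)) a = true := by
  induction t with
  | zero => exact ⟨rfl, by simp⟩
  | succ t ih =>
    obtain ⟨hb, ha⟩ := ih
    have hc := counter_iterate_initState φ t
    rw [Function.iterate_succ_apply']
    set s := (hardStep φ)^[t] (initState k) with hs
    have hx : (∀ j, s (x j) = true) ↔ t % 2 ^ k = 2 ^ k - 1 := by
      rw [← forall_testBit_iff]
      exact forall_congr' fun j => by rw [← show counter s (Sum.inr j) = t.testBit j by rw [hc]; rfl]; rfl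
    have hA : ∀ j ≤ t, j / 2 ^ k = t / 2 ^ k → φ.eval (counterOf k j) = false →
        stepA φ s = true := by
      intro j hj hq hj'
      rcases hj.lt_or_eq with hlt | rfl
      · simp [stepA, ha j hlt hq hj']
      · simp [stepA, hc, hj']
    have hpos : 0 < 2 ^ k := Nat.two_pow_pos k
    refine ⟨?_, fun j hj hq hj' => ?_⟩
    · change stepB φ s = true
      by_cases h : ∀ j, s (x j) = true
      · obtain ⟨X, hX, hφX⟩ := hφ (t / 2 ^ k)
        have h1 := Nat.div_add_mod t (2 ^ k)
        have : stepA φ s = true := hA _ (by rw [hx.1 h] at h1; omega)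
          (by rw [Nat.mul_add_div hpos, Nat.div_eq_of_lt hX, Nat.add_zero]) hφX
        simp [stepB, hb, this]
      · simp [stepB, hb, h]
    · have hjt : j / 2 ^ k ≤ t / 2 ^ k := Nat.div_le_div_right (Nat.lt_succ_iff.1 hj)
      have htt : t / 2 ^ k ≤ (t + 1) / 2 ^ k := Nat.div_le_div_right (Nat.le_succ t)
      -- Times `j ≤ t` and `t + 1` lie in one row, so `t` is not the end of a row and `a` is not
      -- reset.
      have hnx : ¬ ∀ j, s (x j) = true := by
        rw [hx]
        intro h
        have h1 := Nat.div_add_mod t (2 ^ k)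
        rw [h] at h1
        have h2 : t + 1 = (t / 2 ^ k + 1) * 2 ^ k := by rw [Nat.add_mul, Nat.mul_comm]; omega
        have h3 : (t + 1) / 2 ^ k = t / 2 ^ k + 1 := by
          conv_lhs => rw [h2]
          exact Nat.mul_div_cancel _ hpos
        omega
      exact (if_neg hnx).trans (hA j (Nat.lt_succ_iff.1 hj) (by omega) hj')

theorem not_hasPolyInvariant_hardSystem {φ : PropFormula (Fin k ⊕ Fin k)} {p : Polynomial ℝ}
    (hφ : ∀ Y, ∃ X < 2 ^ k, φ.eval (counterOf k (2 ^ k * Y + X)) = false) :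
    ¬ (hardSystem k φ).HasPolyInvariant p := by
  rintro ⟨I, -, hinit, hstep, hbad⟩
  have hI : ∀ t, I.Holds ((hardStep φ)^[t] (initState k)) := by
    intro t
    induction t with
    | zero => exact hinit _ (holds_hardInit_initState k)
    | succ t ih =>
      rw [Function.iterate_succ_apply']
      exact hstep _ _ ih ((step_hardTrans_iff _ _ _).2 rfl)
  -- At this time the counter is all ones; the next step copies `b`, still true, into `e`.
  let t := 2 ^ (2 * k) - 1
  refine hbad _ (hI (t + 1)) ?_
  have hy : ∀ j, ((hardStep φ)^[t] (initState k)) (y j) = true := by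
    intro j
    have h := congrFun (counter_iterate_initState φ t) (Sum.inl j)
    refine h.trans ?_
    simp only [counterOf, t, Nat.testBit_two_pow_sub_one, decide_eq_true_eq]
    omega
  have hb := (iterate_hardStep_initState hφ (t + 1)).1
  rw [Function.iterate_succ_apply'] at hb ⊢
  exact (if_pos hy).trans hb

end HardVar

/-! ## Oracles with prescribed answers -/

section Oracle

variable {V : Type}

theorem boundedReach_iff_nat (δ : TransFormula V) (t : ℕ) (α β : PropFormula V) :
    BoundedReach δ t α β ↔ ∀ s : ℕ → PropState V, α.Holds (s 0) →
      (∀ i < t, δ.Step (s i) (s (i + 1))) → β.Holds (s t) := by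
  constructor
  · intro h s hs hstep
    exact h (fun i => s i) hs fun i => hstep i i.2
  · intro h s hs hstep
    have := h (fun i => if hi : i < t + 1 then s ⟨i, hi⟩ else s 0) (by simpa using hs) fun i hi => by
      simpa [hi, hi.trans (Nat.lt_succ_self t)] using hstep ⟨i, hi⟩
    simpa [Fin.last] using this

/-- `r` is an answer to the query `q` about `δ` that an interpolation-query oracle may give. -/
def ItpQuery.IsAnswer (δ : TransFormula V) (q : ItpQuery V) (r : Option (PropFormula V)) : Prop :=
  (¬ BoundedReach δ (q.k₁ + q.k₂) q.pre q.post → r = none) ∧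
  (BoundedReach δ (q.k₁ + q.k₂) q.pre q.post →
    ∃ ρ, r = some ρ ∧ BoundedReach δ q.k₁ q.pre ρ ∧ BoundedReach δ q.k₂ ρ q.post)

/-- The set of states reachable from `q.pre` in `q.k₁` steps is an interpolant, and on a finite
vocabulary it is defined by a formula. -/
theorem ItpQuery.exists_isAnswer [Finite V] (δ : TransFormula V) (q : ItpQuery V) :
    ∃ r, q.IsAnswer δ r := by
  classical
  by_cases hq : BoundedReach δ (q.k₁ + q.k₂) q.pre q.post
  · obtain ⟨ρ, hρ⟩ := PropFormula.exists_eval_eq fun u : PropState V => decide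
      (∃ s : ℕ → PropState V, q.pre.Holds (s 0) ∧ (∀ i < q.k₁, δ.Step (s i) (s (i + 1))) ∧ s q.k₁ = u)
    refine ⟨some ρ, fun h => absurd hq h, fun _ => ⟨ρ, rfl, ?_, ?_⟩⟩
    · rw [boundedReach_iff_nat]
      intro s hs hstep
      rw [PropFormula.Holds, hρ, decide_eq_true_eq]
      exact ⟨s, hs, hstep, rfl⟩
    · rw [boundedReach_iff_nat] at hq ⊢
      intro s' hs' hstep'
      rw [PropFormula.Holds, hρ, decide_eq_true_eq] at hs'
      obtain ⟨s, hs, hstep, heq⟩ := hs'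
      have := hq (fun i => if i ≤ q.k₁ then s i else s' (i - q.k₁)) (by simpa using hs) fun i hi => by
        rcases lt_trichotomy i q.k₁ with h | rfl | h
        · simpa [h.le, h] using hstep i h
        · simpa [heq] using hstep' 0 (by omega)
        · have h1 : ¬ i ≤ q.k₁ := by omega
          have h2 : ¬ i + 1 ≤ q.k₁ := by omega
          simpa [h1, h2, show i + 1 - q.k₁ = i - q.k₁ + 1 by omega] using hstep' (i - q.k₁) (by omega)
      -- For `q.k₂ = 0` the concatenated run ends in its first branch, at `s q.k₁ = s' 0`.
      by_cases h0 : q.k₂ = 0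
      · simpa [h0, heq] using this
      · simpa [h0] using this
  · exact ⟨none, fun _ => rfl, fun h => absurd h hq⟩

theorem itp_nonempty : itp.Nonempty := by
  refine ⟨fun V _ δ α β k₁ k₂ => (ItpQuery.exists_isAnswer δ ⟨α, β, k₁, k₂⟩).choose, ?_⟩
  intro V _ δ α β k₁ k₂
  exact (ItpQuery.exists_isAnswer δ ⟨α, β, k₁, k₂⟩).choose_spec

/-- The oracle `Q` gives the answers of the history `h` about `δ`. -/
def ItpOracle.Agrees [Finite V] (Q : ItpOracle) (δ : TransFormula V) (h : ItpHistory V) : Prop :=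
  ∀ c ∈ h, Q V δ c.1.pre c.1.post c.1.k₁ c.1.k₂ = c.2

/-- An arbitrary oracle is overwritten at the queries of `h` about `δ` alone. An oracle is a
function, so repeated queries in `h` must carry equal answers; this is `hfun`. -/
theorem exists_mem_itp_agrees [Finite V] {δ : TransFormula V} {h : ItpHistory V}
    (hans : ∀ c ∈ h, c.1.IsAnswer δ c.2) (hfun : ∀ c ∈ h, ∀ c' ∈ h, c.1 = c'.1 → c.2 = c'.2) :
    ∃ Q ∈ itp, Q.Agrees δ h := by
  classical
  obtain ⟨Q₀, hQ₀⟩ := itp_nonempty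
  let f : TransFormula V → PropFormula V → PropFormula V → ℕ → ℕ → Option (PropFormula V) :=
    fun δ' α β k₁ k₂ => if hr : δ' = δ ∧ ∃ r, ((⟨α, β, k₁, k₂⟩ : ItpQuery V), r) ∈ h then hr.2.choose
      else Q₀ V δ' α β k₁ k₂
  let Q : ItpOracle := Function.update
    (β := fun V : Type => [Finite V] → TransFormula V → PropFormula V → PropFormula V → ℕ → ℕ →
      Option (PropFormula V)) Q₀ V f
  have hQV : ∀ δ' α β k₁ k₂, Q V δ' α β k₁ k₂ = f δ' α β k₁ k₂ := by
    intro δ' α β k₁ k₂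
    simp only [Q, Function.update_self]
  refine ⟨Q, ?_, ?_⟩
  · intro W _ δ' α β k₁ k₂
    by_cases hW : W = V
    · subst hW
      rw [hQV]
      by_cases hr : δ' = δ ∧ ∃ r, ((⟨α, β, k₁, k₂⟩ : ItpQuery W), r) ∈ h
      · have hfr : f δ' α β k₁ k₂ = hr.2.choose := dif_pos hr
        have := hans _ hr.2.choose_spec
        rw [hfr]
        obtain ⟨rfl, -⟩ := id hr
        exact this
      · have hfr : f δ' α β k₁ k₂ = Q₀ W δ' α β k₁ k₂ := dif_neg hr
        rw [hfr]
        exact hQ₀ W δ' α β k₁ k₂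
    · have hQW : Q W δ' α β k₁ k₂ = Q₀ W δ' α β k₁ k₂ := by
        simp only [Q, Function.update_of_ne hW]
      rw [hQW]
      exact hQ₀ W δ' α β k₁ k₂
  · rintro ⟨q, r⟩ hc
    have hr : δ = δ ∧ ∃ r, ((⟨q.pre, q.post, q.k₁, q.k₂⟩ : ItpQuery V), r) ∈ h := ⟨rfl, r, hc⟩
    have hfr : f δ q.pre q.post q.k₁ q.k₂ = hr.2.choose := dif_pos hr
    rw [hQV, hfr]
    exact hfun _ hr.2.choose_spec _ hc rfl

end Oracle

/-! ## The adversary -/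

namespace HardVar

variable {k : ℕ}

/-- The formulas `φ` and `ψ` have the same value at the valuations in `D`. -/
def EqOn (D : Finset (PropState (Fin k ⊕ Fin k))) (φ ψ : PropFormula (Fin k ⊕ Fin k)) : Prop :=
  ∀ w ∈ D, φ.eval w = ψ.eval w

/-- A query has an answer that is correct for all formulas `φ` with certain values at few valuations. -/
theorem exists_answer (D : Finset (PropState (Fin k ⊕ Fin k))) (φ₀ : PropFormula (Fin k ⊕ Fin k))
    (q : ItpQuery (HardVar k)) (hq : q.k₁ + q.k₂ ≤ 2 ^ (2 * k)) :
    ∃ D' φ₁ r, D ⊆ D' ∧ D'.card ≤ D.card + (q.k₁ + q.k₂) ∧ EqOn D φ₁ φ₀ ∧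
      ∀ φ, EqOn D' φ φ₁ → q.IsAnswer (hardTrans φ) r := by
  classical
  by_cases hall : ∀ φ, EqOn D φ φ₀ → BoundedReach (hardTrans φ) (q.k₁ + q.k₂) q.pre q.post
  -- One interpolant for all candidates: the union, over every `φ` still possible, of the states
  -- reached in `q.k₁` steps. Nothing new is fixed.
  · obtain ⟨ρ, hρ⟩ := PropFormula.exists_eval_eq fun u : PropState (HardVar k) => decide
      (∃ φ s, EqOn D φ φ₀ ∧ q.pre.Holds s ∧ (hardStep φ)^[q.k₁] s = u)
    refine ⟨D, φ₀, some ρ, subset_rfl, by omega, fun _ _ => rfl, fun ψ hψ =>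
      ⟨fun h => absurd (hall ψ hψ) h, fun _ => ⟨ρ, rfl, ?_, ?_⟩⟩⟩
    · rw [boundedReach_hardTrans_iff]
      intro s hs
      rw [PropFormula.Holds, hρ, decide_eq_true_eq]
      exact ⟨ψ, s, hψ, hs, rfl⟩
    · rw [boundedReach_hardTrans_iff]
      intro u hu
      rw [PropFormula.Holds, hρ, decide_eq_true_eq] at hu
      obtain ⟨φ, s, hφ, hs, rfl⟩ := hu
      -- `χ` follows `φ` at the counter values of the first half and `ψ` elsewhere. It is still a
      -- candidate, so its run, which is the glued run, ends in `q.post`.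
      obtain ⟨χ, hχ⟩ := PropFormula.exists_eval_eq fun w : PropState (Fin k ⊕ Fin k) =>
        if ∃ i < q.k₁, incCounter^[i] (counter s) = w then φ.eval w else ψ.eval w
      have hχD : EqOn D χ φ₀ := by
        intro w hw
        rw [hχ]
        split_ifs
        · exact hφ w hw
        · exact hψ w hw
      rw [← iterate_hardStep_glue (χ := χ) s]
      · exact (boundedReach_hardTrans_iff _ _ _ _).1 (hall χ hχD) s hs
      · intro i hi
        rw [hχ, if_pos ⟨i, hi, rfl⟩]
      · intro i hi
        rw [hχ, if_neg]
        rintro ⟨j, hj, hij⟩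
        have := iterate_incCounter_inj _ (by omega) (by omega) hij
        omega
  · push Not at hall
    obtain ⟨φ₁, hφ₁, hfail⟩ := hall
    have hfail' := hfail
    rw [boundedReach_hardTrans_iff] at hfail'
    push Not at hfail'
    obtain ⟨s, hs, hns⟩ := hfail'
    -- Fixing `φ₁` along the failing run preserves that run, and with it the answer `⊥`.
    refine ⟨D ∪ (Finset.range (q.k₁ + q.k₂)).image fun i => incCounter^[i] (counter s), φ₁, none,
      Finset.subset_union_left, ?_, hφ₁, fun φ hφ => ?_⟩
    · refine (Finset.card_union_le _ _).trans (Nat.add_le_add_left ?_ _)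
      exact Finset.card_image_le.trans (Finset.card_range _).le
    · have hnot : ¬ BoundedReach (hardTrans φ) (q.k₁ + q.k₂) q.pre q.post := by
        rw [boundedReach_hardTrans_iff]
        intro h
        apply hns
        rw [← iterate_hardStep_congr (φ := φ)]
        · exact h s hs
        · intro i hi
          exact hφ _ (Finset.mem_union_right _
            (Finset.mem_image_of_mem (fun i => incCounter^[i] (counter s)) (Finset.mem_range.2 hi)))
      exact ⟨fun _ => rfl, fun h => absurd h hnot⟩

/-! ### Runs of an algorithm against the adversary. -/

variable (A : InferenceAlgorithm)

theorem history_succ_of_query {Q : ItpOracle} {ts : TransitionSystem} {t : ℕ} {q : ItpQuery ts.Voc}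
    (h : A.action ts (A.history Q ts t) = Sum.inl q) :
    A.history Q ts (t + 1) =
      (q, Q ts.Voc ts.trans q.pre q.post q.k₁ q.k₂) :: A.history Q ts t := by
  rw [InferenceAlgorithm.history, h]

theorem history_succ_of_halt {Q : ItpOracle} {ts : TransitionSystem} {t : ℕ} {ans : Bool}
    (h : A.action ts (A.history Q ts t) = Sum.inr ans) :
    A.history Q ts (t + 1) = A.history Q ts t := by
  rw [InferenceAlgorithm.history, h]

theorem history_of_halt {Q : ItpOracle} {ts : TransitionSystem} {t : ℕ} {ans : Bool}
    (h : A.action ts (A.history Q ts t) = Sum.inr ans) {t' : ℕ} (ht : t ≤ t') :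
    A.history Q ts t' = A.history Q ts t := by
  induction t', ht using Nat.le_induction with
  | base => rfl
  | succ t' _ ih => rw [history_succ_of_halt A (ans := ans) (by rw [ih, h]), ih]

theorem haltsWith_unique {Q : ItpOracle} {ts : TransitionSystem} {ans ans' : Bool}
    (h : A.HaltsWith Q ts ans) (h' : A.HaltsWith Q ts ans') : ans = ans' := by
  obtain ⟨t, ht⟩ := h
  obtain ⟨t', ht'⟩ := h'
  rcases le_total t t' with hle | hle
  · rw [history_of_halt A ht hle, ht] at ht'
    exact Sum.inr.inj ht'
  · rw [history_of_halt A ht' hle, ht'] at ht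
    exact (Sum.inr.inj ht).symm

theorem length_history_or_halt (Q : ItpOracle) (ts : TransitionSystem) (t : ℕ) :
    (A.history Q ts t).length = t ∨ ∃ ans, A.action ts (A.history Q ts t) = Sum.inr ans := by
  induction t with
  | zero => exact Or.inl rfl
  | succ t ih =>
    cases hact : A.action ts (A.history Q ts t) with
    | inl q =>
      left
      rw [history_succ_of_query A hact, List.length_cons]
      rcases ih with ih | ⟨ans, hans⟩
      · rw [ih]
      · rw [hact] at hans
        cases hans
    | inr ans =>
      right
      exact ⟨ans, by rw [history_succ_of_halt A hact, hact]⟩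

/-- A transcript of `t` steps that is consistent with all formulas `φ` with certain values at few
valuations. -/
theorem exists_transcript {B : ℕ} (hB : ∀ Q ∈ itp, ∀ φ, ∀ q : ItpQuery (HardVar k),
      A.Performs Q (hardSystem k φ) q → q.k₁ + q.k₂ ≤ B)
    (hBk : B ≤ 2 ^ (2 * k)) (t : ℕ) :
    ∃ (h : ItpHistory (HardVar k)) (D : Finset (PropState (Fin k ⊕ Fin k)))
      (φ₀ : PropFormula (Fin k ⊕ Fin k)), D.card ≤ t * B ∧
      (∀ c ∈ h, ∀ c' ∈ h, c.1 = c'.1 → c.2 = c'.2) ∧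
      ∀ φ, EqOn D φ φ₀ → (∀ c ∈ h, c.1.IsAnswer (hardTrans φ) c.2) ∧
        ∀ Q : ItpOracle, Q.Agrees (hardTrans φ) h → A.history Q (hardSystem k φ) t = h := by
  induction t with
  | zero => exact ⟨[], ∅, .tru, by simp, by simp, fun φ _ => ⟨by simp, fun Q _ => rfl⟩⟩
  | succ t ih =>
    obtain ⟨h, D, φ₀, hD, hfun, hφ⟩ := ih
    -- `Init`, `Bad` and the vocabulary do not depend on `φ`, so the next action is determined by
    -- `h` alone.
    cases hact : A.next (HardVar k) (hardInit k) (hardBad k) h with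
    | inr ans =>
      refine ⟨h, D, φ₀, hD.trans (Nat.mul_le_mul_right _ (Nat.le_succ t)), hfun, fun φ hφD =>
        ⟨(hφ φ hφD).1, fun Q hQ => ?_⟩⟩
      have hh := (hφ φ hφD).2 Q hQ
      rw [history_succ_of_halt A (ans := ans), hh]
      rw [hh]
      exact hact
    | inl q =>
      have hqact : ∀ φ, EqOn D φ φ₀ → ∀ Q : ItpOracle, Q.Agrees (hardTrans φ) h →
          A.action (hardSystem k φ) (A.history Q (hardSystem k φ) t) = Sum.inl q := by
        intro φ hφD Q hQ
        rw [(hφ φ hφD).2 Q hQ]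
        exact hact
      have hstep : ∀ φ, EqOn D φ φ₀ → ∀ Q : ItpOracle, ∀ r, Q.Agrees (hardTrans φ) ((q, r) :: h) →
          A.history Q (hardSystem k φ) (t + 1) = (q, r) :: h := by
        intro φ hφD Q r hQ
        have hQ' : Q.Agrees (hardTrans φ) h := fun c hc => hQ c (List.mem_cons_of_mem _ hc)
        rw [history_succ_of_query A (hqact φ hφD Q hQ'), (hφ φ hφD).2 Q hQ']
        congr 2
        exact hQ (q, r) List.mem_cons_self
      -- A repeated query must receive its earlier answer.
      by_cases hq : ∃ r, (q, r) ∈ h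
      · obtain ⟨r, hr⟩ := hq
        have hmem : ∀ c ∈ (q, r) :: h, c ∈ h := by
          intro c hc
          rcases List.mem_cons.1 hc with rfl | hc
          · exact hr
          · exact hc
        exact ⟨(q, r) :: h, D, φ₀, hD.trans (Nat.mul_le_mul_right _ (Nat.le_succ t)),
          fun c hc c' hc' => hfun c (hmem c hc) c' (hmem c' hc'), fun φ hφD =>
          ⟨fun c hc => (hφ φ hφD).1 c (hmem c hc), fun Q hQ => hstep φ hφD Q r hQ⟩⟩
      -- The depth bound concerns actual runs only; the candidate `φ₀` with an oracle that agrees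
      -- with `h` supplies one that performs `q`.
      · have hqB : q.k₁ + q.k₂ ≤ B := by
          have hself : EqOn D φ₀ φ₀ := fun _ _ => rfl
          obtain ⟨Q, hQ, hQh⟩ := exists_mem_itp_agrees (hφ φ₀ hself).1 hfun
          exact hB Q hQ φ₀ q ⟨t, hqact φ₀ hself Q hQh⟩
        obtain ⟨D', φ₁, r, hDD', hcard, hφ₁, hr⟩ := exists_answer D φ₀ q (hqB.trans hBk)
        have hsub : ∀ φ, EqOn D' φ φ₁ → EqOn D φ φ₀ := fun φ hφ' w hw =>
          (hφ' w (hDD' hw)).trans (hφ₁ w hw)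
        refine ⟨(q, r) :: h, D', φ₁, by rw [Nat.succ_mul]; omega, ?_, fun φ hφ' =>
          ⟨?_, fun Q hQ => hstep φ (hsub φ hφ') Q r hQ⟩⟩
        · intro c hc c' hc' heq
          rcases List.mem_cons.1 hc with rfl | hc <;> rcases List.mem_cons.1 hc' with rfl | hc'
          · rfl
          · exact absurd ⟨c'.2, by rw [show q = c'.1 from heq]; exact hc'⟩ hq
          · exact absurd ⟨c.2, by rw [show q = c.1 from heq.symm]; exact hc⟩ hq
          · exact hfun c hc c' hc' heq
        · intro c hc
          rcases List.mem_cons.1 hc with rfl | hc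
          · exact hr φ hφ'
          · exact (hφ φ (hsub φ hφ')).1 c hc

/-- Few fixed values of `φ` leave open whether `∃ y, ∀ x, φ(y, x)`. -/
theorem exists_eqOn (D : Finset (PropState (Fin k ⊕ Fin k))) (φ₀ : PropFormula (Fin k ⊕ Fin k))
    {m : ℕ} (hmk : m ≤ k) (hD : D.card + 1 < 2 ^ m) :
    (∃ φ u, EqOn D φ φ₀ ∧ (∀ i : Fin k, m ≤ i → u i = true) ∧ (¬ ∀ i, u i = true) ∧
      ∀ v, φ.eval (pair u v) = true) ∧
    ∃ φ, EqOn D φ φ₀ ∧ ∀ Y, ∃ X < 2 ^ k, φ.eval (counterOf k (2 ^ k * Y + X)) = false := by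
  classical
  constructor
  -- The `2 ^ m` vectors with ones from index `m` on. The number `2 ^ m - 1` gives the all-ones
  -- vector and is left out; some remaining row avoids `D`, and `φ` is made true off `D`.
  · let u : ℕ → Fin k → Bool := fun n i => n.testBit i || decide (m ≤ i)
    have hu : ∀ n n' i, n < 2 ^ m → n' < 2 ^ m → u n = u n' → n.testBit i = n'.testBit i := by
      intro n n' i hn hn' h
      rcases lt_or_ge i m with hi | hi
      · have := congrFun h ⟨i, hi.trans_le hmk⟩
        simpa [u, not_le.2 hi] using this
      · rw [Nat.testBit_lt_two_pow (hn.trans_le (Nat.pow_le_pow_right (by norm_num) hi)),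
          Nat.testBit_lt_two_pow (hn'.trans_le (Nat.pow_le_pow_right (by norm_num) hi))]
    have hinj : Set.InjOn u (Finset.range (2 ^ m - 1)) := by
      intro n hn n' hn' h
      simp only [Finset.coe_range, Set.mem_Iio] at hn hn'
      exact Nat.eq_of_testBit_eq fun i => hu n n' i (by omega) (by omega) h
    obtain ⟨_, hmem, hnot⟩ := Finset.exists_mem_notMem_of_card_lt_card
      (s := D.image fun w i => w (Sum.inl i)) (t := (Finset.range (2 ^ m - 1)).image u) (by
        rw [Finset.card_image_of_injOn hinj, Finset.card_range]
        exact Finset.card_image_le.trans_lt (by omega))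
    obtain ⟨n, hn, rfl⟩ := Finset.mem_image.1 hmem
    rw [Finset.mem_range] at hn
    obtain ⟨φ, hφ⟩ := PropFormula.exists_eval_eq fun w : PropState (Fin k ⊕ Fin k) =>
      if w ∈ D then φ₀.eval w else true
    refine ⟨φ, u n, fun w hw => by rw [hφ, if_pos hw], fun i hi => by simp [u, hi], fun hall => ?_,
      fun v => ?_⟩
    · have : n = 2 ^ m - 1 := by
        refine Nat.eq_of_testBit_eq fun i => hu _ _ i (by omega) (by omega) (funext fun j => ?_)
        rw [hall j]
        simp [u, Nat.testBit_two_pow_sub_one, lt_or_ge]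
      omega
    · rw [hφ, if_neg]
      intro hw
      exact hnot (Finset.mem_image.2 ⟨_, hw, rfl⟩)
  · obtain ⟨φ, hφ⟩ := PropFormula.exists_eval_eq fun w : PropState (Fin k ⊕ Fin k) =>
      if w ∈ D then φ₀.eval w else false
    refine ⟨φ, fun w hw => by rw [hφ, if_pos hw], fun Y => ?_⟩
    have hinj : Set.InjOn (fun X => counterOf k (2 ^ k * Y + X)) (Finset.range (2 ^ k)) := by
      intro X hX X' hX' h
      simp only [Finset.coe_range, Set.mem_Iio] at hX hX'
      have hle : 2 ^ k ≤ 2 ^ (2 * k) := Nat.pow_le_pow_right (by norm_num) (by omega)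
      exact Nat.ModEq.eq_of_lt_of_lt (Nat.ModEq.add_left_cancel' _ (counterOf_eq_iff.1 h))
        (hX.trans_le hle) (hX'.trans_le hle)
    obtain ⟨_, hmem, hnot⟩ := Finset.exists_mem_notMem_of_card_lt_card
      (s := D) (t := (Finset.range (2 ^ k)).image fun X => counterOf k (2 ^ k * Y + X)) (by
        rw [Finset.card_image_of_injOn hinj, Finset.card_range]
        have : 2 ^ m ≤ 2 ^ k := Nat.pow_le_pow_right (by norm_num) hmk
        omega)
    obtain ⟨X, hX, rfl⟩ := Finset.mem_image.1 hmem
    exact ⟨X, Finset.mem_range.1 hX, by rw [hφ, if_neg hnot]⟩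

/-- The transcript of `T` steps is common to a system with a short invariant and to one with none.
Halting within it would give both the same answer, so all `T` steps are queries. -/
theorem le_queryComplexity {A : InferenceAlgorithm} {p : Polynomial ℝ} (hdec : A.DecidesInference hardClass p) {B m T : ℕ}
    (hB : ∀ Q ∈ itp, ∀ φ, ∀ q : ItpQuery (HardVar k),
      A.Performs Q (hardSystem k φ) q → q.k₁ + q.k₂ ≤ B)
    (hBk : B ≤ 2 ^ (2 * k)) (hmk : m ≤ k) (hT : T * B + 1 < 2 ^ m)
    (hm : ((m + 2 : ℕ) : ℝ) ≤ p.eval ((2 * k + 3 : ℕ) : ℝ)) :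
    (T : ℕ∞) ≤ A.queryComplexity itp hardClass (2 * k + 3) := by
  obtain ⟨h, D, φ₀, hD, hfun, hφ⟩ := exists_transcript A hB hBk T
  obtain ⟨⟨φ₁, u, h₁, hum, hu, hφ₁⟩, φ₂, h₂, hφ₂⟩ := exists_eqOn D φ₀ hmk (by omega)
  obtain ⟨Q₁, hQ₁, hQh₁⟩ := exists_mem_itp_agrees (hφ φ₁ h₁).1 hfun
  obtain ⟨Q₂, hQ₂, hQh₂⟩ := exists_mem_itp_agrees (hφ φ₂ h₂).1 hfun
  have hist₁ := (hφ φ₁ h₁).2 Q₁ hQh₁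
  have hist₂ := (hφ φ₂ h₂).2 Q₂ hQh₂
  have hlen : (A.history Q₁ (hardSystem k φ₁) T).length = T := by
    rcases length_history_or_halt A Q₁ (hardSystem k φ₁) T with hl | ⟨ans, hans⟩
    · exact hl
    · exfalso
      have halt₁ : A.HaltsWith Q₁ (hardSystem k φ₁) ans := ⟨T, hans⟩
      have halt₂ : A.HaltsWith Q₂ (hardSystem k φ₂) ans := by
        refine ⟨T, ?_⟩
        rw [hist₁] at hans
        rw [hist₂]
        exact hans
      obtain ⟨ans₁, hans₁, hiff₁⟩ := hdec Q₁ hQ₁ _ ⟨k, φ₁, rfl⟩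
      obtain ⟨ans₂, hans₂, hiff₂⟩ := hdec Q₂ hQ₂ _ ⟨k, φ₂, rfl⟩
      obtain rfl := haltsWith_unique A halt₁ hans₁
      obtain rfl := haltsWith_unique A halt₂ hans₂
      refine not_hasPolyInvariant_hardSystem hφ₂ (hiff₂.1 (hiff₁.2 ?_))
      refine hasPolyInvariant_hardSystem (m := m) ?_ hum hu hφ₁
      rwa [show (hardSystem k φ₁).size = 2 * k + 3 from card_hardVar k]
  calc (T : ℕ∞) = ((A.history Q₁ (hardSystem k φ₁) T).length : ℕ∞) := by rw [hlen]
    _ ≤ A.numQueries Q₁ (hardSystem k φ₁) :=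
      le_iSup (fun t : ℕ => ((A.history Q₁ (hardSystem k φ₁) t).length : ℕ∞)) T
    _ ≤ A.queryComplexity itp hardClass (2 * k + 3) :=
      le_iSup₂_of_le Q₁ hQ₁ (le_iSup₂_of_le (hardSystem k φ₁) ⟨k, φ₁, rfl⟩
        (le_iSup_of_le (card_hardVar k) le_rfl))

end HardVar

/-! ### Asymptotics and the choice of parameters. -/

/-- Polynomials grow more slowly than exponentials. -/
theorem eventually_polynomial_le_two_rpow (P : Polynomial ℝ) {c : ℝ} (hc : 0 < c) :
    ∀ᶠ k : ℕ in atTop, P.eval (k : ℝ) ≤ (2 : ℝ) ^ (c * k) := by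
  have h1 : (fun x : ℝ => P.eval x) =O[atTop] fun x : ℝ => x ^ P.natDegree := by
    simpa using Polynomial.isBigO_atTop_of_degree_le P (Polynomial.X ^ P.natDegree)
      (by rw [Polynomial.degree_X_pow]; exact Polynomial.degree_le_natDegree)
  have h2 : (fun k : ℕ => (k : ℝ) ^ P.natDegree) =o[atTop] fun k : ℕ => ((2 : ℝ) ^ c) ^ k :=
    isLittleO_pow_const_const_pow_of_one_lt _ (Real.one_lt_rpow (by norm_num) hc)
  have h3 := (h1.comp_tendsto tendsto_natCast_atTop_atTop).trans_isLittleO h2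
  filter_upwards [h3.bound one_pos] with k hk
  rw [one_mul, ← Real.rpow_natCast, ← Real.rpow_mul (by norm_num),
    Real.norm_of_nonneg (Real.rpow_nonneg (by norm_num) _)] at hk
  exact (le_abs_self _).trans hk

/-- Every interpolation-query algorithm that decides polynomial-length inference for the class
`P_{Σ₂}` has query complexity `2^{Ω(n)}`. The class has systems with vocabulary of size `n` exactly when
`n = 2 * k + 3` for some `k`, and the bound ranges over these `n`. -/
theorem mainTheorem4 (p : Polynomial ℝ)
    (hp : ∃ c : ℝ, 0 < c ∧ ∀ᶠ n : ℕ in atTop, c * (n : ℝ) ≤ p.eval (n : ℝ))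
    (A : InferenceAlgorithm) (hdepth : A.HasPolyDepth hardClass)
    (hdec : A.DecidesInference hardClass p) :
    ∃ c : ℝ, 0 < c ∧ ∀ᶠ k : ℕ in atTop,
      (2 : ℝ≥0∞) ^ (c * ((2 * k + 3 : ℕ) : ℝ)) ≤
        ((A.queryComplexity itp hardClass (2 * k + 3) : ℕ∞) : ℝ≥0∞) := by
  obtain ⟨c₀, hc₀, hp⟩ := hp
  obtain ⟨r, hr⟩ := hdepth
  obtain ⟨c, hc, hcc₀, hc1⟩ : ∃ c : ℝ, 0 < c ∧ c ≤ c₀ ∧ c ≤ 1 :=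
    ⟨min c₀ 1, by positivity, min_le_left _ _, min_le_right _ _⟩
  -- The number of forced queries is `⌈h⌉₊` with `h = 2 ^ (c / 2 * k)`, and `c / 8 * (2 * k + 3) ≤ c
  -- / 2 * k` for `k ≥ 2`.
  refine ⟨c / 8, by positivity, ?_⟩
  have htend : Tendsto (fun k : ℕ => 2 * k + 3) atTop atTop :=
    tendsto_atTop_mono (fun k => by simp only [id]; omega) tendsto_id
  -- This is `8 * B`, where `B` bounds `k₁ + k₂`; the summand 1 ensures `B ≥ 1`.
  let P : Polynomial ℝ := 8 * (2 * (r.map (Nat.castRingHom ℝ)).comp (2 * Polynomial.X + 3) + 1)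
  have hP : ∀ k : ℕ, P.eval (k : ℝ) = 8 * ((2 * r.eval (2 * k + 3) + 1 : ℕ) : ℝ) := by
    intro k
    have : ((r.map (Nat.castRingHom ℝ)).eval ((2 * k + 3 : ℕ) : ℝ)) = ((r.eval (2 * k + 3) : ℕ) : ℝ) := by
      rw [Polynomial.eval_natCast_map]
      simp
    push_cast at this ⊢
    simp [P, this]
  filter_upwards [htend.eventually hp,
    eventually_polynomial_le_two_rpow P (c := c / 2) (by positivity),
    eventually_ge_atTop 2, eventually_ge_atTop ⌈2 / c⌉₊] with k hpk hPk hk2 hkc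
  rw [hP] at hPk
  set B := 2 * r.eval (2 * k + 3) + 1 with hBdef
  set m := ⌊c * k⌋₊ with hm
  have hk : (0 : ℝ) ≤ k := Nat.cast_nonneg k
  have hmle : (m : ℝ) ≤ c * k := Nat.floor_le (by positivity)
  have hmlt : c * k < m + 1 := Nat.lt_floor_add_one _
  -- Used for the clause count: `m + 2 ≤ 2 * (c * k)`, which is below `c₀ * (2 * k + 3)`.
  have hck : 2 ≤ c * k := by
    have := (Nat.le_ceil (2 / c)).trans (Nat.cast_le.2 hkc)
    rwa [div_le_iff₀ hc, mul_comm] at this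
  have hmk : m ≤ k := by
    have : (m : ℝ) ≤ k := hmle.trans (mul_le_of_le_one_left hk hc1)
    exact_mod_cast this
  set h : ℝ := (2 : ℝ) ^ (c / 2 * k) with hh
  have hh1 : 1 ≤ h := Real.one_le_rpow (by norm_num) (by positivity)
  have hB1 : (1 : ℝ) ≤ B := by exact_mod_cast (by omega : 1 ≤ B)
  have hhh : h * h < 2 * (2 : ℝ) ^ m := by
    calc h * h = (2 : ℝ) ^ (c * k) := by rw [hh, ← Real.rpow_add (by norm_num)]; ring_nf
      _ < (2 : ℝ) ^ ((m : ℝ) + 1) := Real.rpow_lt_rpow_of_exponent_lt (by norm_num) hmlt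
      _ = 2 * (2 : ℝ) ^ m := by
        rw [Real.rpow_add (by norm_num), Real.rpow_natCast, Real.rpow_one, mul_comm]
  have hBh : (B : ℝ) ≤ h := by linarith
  have hBk : B ≤ 2 ^ (2 * k) := by
    have : (B : ℝ) ≤ (2 : ℝ) ^ (2 * k) := by
      refine hBh.trans ?_
      rw [hh, ← Real.rpow_natCast]
      refine Real.rpow_le_rpow_of_exponent_le (by norm_num) ?_
      push_cast
      nlinarith
    exact_mod_cast this
  -- The left side is at most `3 * h * B`, and `8 * B ≤ h` with `h * h < 2 * 2 ^ m` bounds this by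
  -- `3 / 4 * 2 ^ m`.
  have hT : ⌈h⌉₊ * B + 1 < 2 ^ m := by
    have hceil : (⌈h⌉₊ : ℝ) ≤ 2 * h := by linarith [Nat.ceil_lt_add_one (by positivity : 0 ≤ h)]
    have : ((⌈h⌉₊ * B + 1 : ℕ) : ℝ) < (2 : ℝ) ^ m := by
      push_cast
      have h1 : (⌈h⌉₊ : ℝ) * B ≤ 2 * h * B := mul_le_mul_of_nonneg_right hceil (by linarith)
      have h2 : h * (8 * B) ≤ h * h := mul_le_mul_of_nonneg_left hPk (by linarith)
      have h3 : 1 ≤ h * B := one_le_mul_of_one_le_of_one_le hh1 hB1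
      linarith
    exact_mod_cast this
  have hmp : ((m + 2 : ℕ) : ℝ) ≤ p.eval ((2 * k + 3 : ℕ) : ℝ) := by
    refine le_trans ?_ hpk
    have : c * ((2 * k + 3 : ℕ) : ℝ) ≤ c₀ * ((2 * k + 3 : ℕ) : ℝ) :=
      mul_le_mul_of_nonneg_right hcc₀ (Nat.cast_nonneg _)
    push_cast at this ⊢
    linarith
  have hmain := HardVar.le_queryComplexity hdec (B := B) (fun Q hQ φ q hq => by
    have := hr Q hQ _ ⟨k, φ, rfl⟩ q hq
    rw [show (hardSystem k φ).size = 2 * k + 3 from HardVar.card_hardVar k] at this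
    omega) hBk hmk hT hmp
  have hle : (2 : ℝ) ^ (c / 8 * ((2 * k + 3 : ℕ) : ℝ)) ≤ (⌈h⌉₊ : ℝ) := by
    refine le_trans (Real.rpow_le_rpow_of_exponent_le (by norm_num) ?_) (Nat.le_ceil h)
    have : (2 : ℝ) ≤ k := by exact_mod_cast hk2
    push_cast
    nlinarith
  calc (2 : ℝ≥0∞) ^ (c / 8 * ((2 * k + 3 : ℕ) : ℝ))
      = ENNReal.ofReal ((2 : ℝ) ^ (c / 8 * ((2 * k + 3 : ℕ) : ℝ))) := by
        rw [← ENNReal.ofReal_rpow_of_pos (by norm_num)]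
        norm_num
    _ ≤ ENNReal.ofReal (⌈h⌉₊ : ℝ) := ENNReal.ofReal_le_ofReal hle
    _ = (((⌈h⌉₊ : ℕ) : ℕ∞) : ℝ≥0∞) := by simp
    _ ≤ _ := ENat.toENNReal_le.2 hmain
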